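/- **Conventions.** A *color* is a finite (possibly empty) strictly increasing sequence $i=(i_1<\dots<i_n)$ of positive integers, identified with the finite set of its entries; $i-j$ denotes $i$ with an entry $j\in i$ removed, and $i+r$ denotes $i$ with a positive integer $r\notin i$ added. A *multiple set* $C$ consists of a set $C_i$ for every color $i$ (with $C_\emptyset$ the set of objects) and maps $s_j,t_j\colon C_i\to C_{i-j}$ for every $j\in i$, such that for $j\neq k$ in $i$: $s_ks_j=s_js_k$, $t_kt_j=t_jt_k$, $t_ks_j=s_jt_k$. A morphism is a family of maps $f_i$, for all colors $i$, commuting with all $s_j$ and $t_j$. This gives the category $\mathbb{M}\mathrm{Sets}$. A *reflexive multiple set* has in addition maps $1_j\colon C_{i-j}\to C_i$ for $j\in i$, such that $s_j1_j=t_j1_j=\mathrm{id}$ and, for $j\ne k$ in $i$, $s_k1_j=1_js_k$, $t_k1_j=1_jt_k$, $1_j1_k=1_k1_j$. A *multiple $\infty$-magma* is a multiple set with, for every color $i$ and $j\in i$, a composite $a\circ_j b\in C_i$ for all $a,b\in C_i$ with $s_j(a)=t_j(b)$, such that $s_j(a\circ_jb)=s_j(b)$, $t_j(a\circ_jb)=t_j(a)$,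 and $s_k(a\circ_jb)=s_k(a)\circ_js_k(b)$, $t_k(a\circ_jb)=t_k(a)\circ_jt_k(b)$ for $k\in i$, $k\neq j$. A *reflexive multiple $\infty$-magma* is a reflexive multiple set and a multiple $\infty$-magma on the same multiple set, with $1_k(a\circ_jb)=1_k(a)\circ_j1_k(b)$ for $j\in i$, $k\notin i$ and $a,b\in C_i$ composable in direction $j$. Its morphisms are the morphisms of multiple sets that preserve the $1_j$ and the $\circ_j$. A *strict multiple $\infty$-category* is a reflexive multiple $\infty$-magma in which every $\circ_j$ is associative and unital, $a\circ_j1_j(s_ja)=a=1_j(t_ja)\circ_ja$, and in which, for $j\neq k$, $(a\circ_jb)\circ_k(c\circ_jd)=(a\circ_kc)\circ_j(b\circ_kd)$ whenever the composites on both sides are defined. A *multiple categorical stretching* consists of a reflexive multiple $\infty$-magma $M$, a strict multiple $\infty$-category $C$, a morphism $\pi\colon M\to C$ of reflexive multiple $\infty$-magmas and, for every color $i$ (including the empty one) and every $r\notin i$, an operation assigning to each pair $\alpha,\beta\in M_i$ with $\pi(\alpha)=\pi(\beta)$ a cell $[\alpha;\beta]_r\in M_{i+r}$ such that * $s_r[\alpha;\beta]_r=\alpha$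 and $t_r[\alpha;\beta]_r=\beta$; * $s_p[\alpha;\beta]_r=[s_p\alpha;s_p\beta]_r$ and $t_p[\alpha;\beta]_r=[t_p\alpha;t_p\beta]_r$ for every $p\in i$; * $\pi([\alpha;\beta]_r)=1_r(\pi(\alpha))=1_r(\pi(\beta))$. A morphism of stretchings $(M,C,\pi,[-;-])\to(M',C',\pi',[-;-]')$ is a pair $(m,c)$ of morphisms of reflexive multiple $\infty$-magmas $m\colon M\to M'$, $c\colon C\to C'$ with $\pi'm=c\pi$ and $m([\alpha;\beta]_r)=[m\alpha;m\beta]'_r$. Stretchings and their morphisms form the category $\infty\text{-}\mathbb{M}\mathbb{E}\mathrm{tC}$. **Proposition.** The forgetful functor $U\colon\infty\text{-}\mathbb{M}\mathbb{E}\mathrm{tC}\to\mathbb{M}\mathrm{Sets}$, $(M,C,\pi,[-;-])\mapsto M$, $(m,c)\mapsto m$, has a left adjoint $F$, and the adjunction $F\dashv U$ induces a monad $\mathbb{M}$ on $\mathbb{M}\mathrm{Sets}$, with underlying functor $UF$, unit the unit $\eta$ of the adjunction, and multiplication $U\varepsilon F$, where $\varepsilon$ is the counit. -/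

import Mathlib

open CategoryTheory

universe u

/-- A color: a finite strictly increasing sequence of positive integers, given by the finite set of
its entries. An `n`-color is a color with `n` entries; the empty color indexes the objects. -/
abbrev Color : Type := Finset ℕ+

/-- `Face i j k` says that `j` is one of the entries of the color `i` and that `k = i - j`
(equivalently, that `j` is not an entry of `k` and that `i = k + j`). All operations below are
indexed by such triples, so that no transport along equalities of colors is needed. -/
structure Face (i : Color) (j : ℕ+) (k : Color) : Prop where
  mem : j ∈ i
  eq_erase : k = i.erase j

/-- Multiple sets: a set of cells for every color, with sources and targets in each direction of
the color. In the three axioms the faces form the square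
`i`, `ij = i - j`, `ik = i - k`, `l = i - j - k`, where `j ≠ k`. -/
structure MultipleSet : Type (u + 1) where
  cell : Color → Type u
  src : ∀ {i k : Color} {j : ℕ+}, Face i j k → cell i → cell k
  tgt : ∀ {i k : Color} {j : ℕ+}, Face i j k → cell i → cell k
  src_src : ∀ {i ij ik l : Color} {j k : ℕ+} (hj : Face i j ij) (hk : Face i k ik)
    (hjk : Face ij k l) (hkj : Face ik j l) (x : cell i),
    src hjk (src hj x) = src hkj (src hk x)
  tgt_tgt : ∀ {i ij ik l : Color} {j k : ℕ+} (hj : Face i j ij) (hk : Face i k ik)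
    (hjk : Face ij k l) (hkj : Face ik j l) (x : cell i),
    tgt hjk (tgt hj x) = tgt hkj (tgt hk x)
  tgt_src : ∀ {i ij ik l : Color} {j k : ℕ+} (hj : Face i j ij) (hk : Face i k ik)
    (hjk : Face ij k l) (hkj : Face ik j l) (x : cell i),
    tgt hjk (src hj x) = src hkj (tgt hk x)

/-- Morphisms of multiple sets. -/
@[ext]
structure MultipleSet.Hom (A B : MultipleSet.{u}) : Type u where
  map : ∀ {i : Color}, A.cell i → B.cell i
  map_src : ∀ {i k : Color} {j : ℕ+} (h : Face i j k) (x : A.cell i),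
    map (A.src h x) = B.src h (map x)
  map_tgt : ∀ {i k : Color} {j : ℕ+} (h : Face i j k) (x : A.cell i),
    map (A.tgt h x) = B.tgt h (map x)

/-- The category of multiple sets. -/
instance : Category.{u} MultipleSet.{u} where
  Hom A B := MultipleSet.Hom A B
  id A :=
    { map := fun x => x
      map_src := fun _ _ => rfl
      map_tgt := fun _ _ => rfl }
  comp f g :=
    { map := fun x => g.map (f.map x)
      map_src := fun h x => by rw [f.map_src, g.map_src]
      map_tgt := fun h x => by rw [f.map_tgt, g.map_tgt] }

/-- Reflexive multiple sets: `refl h : C (i - j) → C i` is the reflexion in direction `j`. -/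
structure ReflMultipleSet : Type (u + 1) extends MultipleSet.{u} where
  refl : ∀ {i k : Color} {j : ℕ+}, Face i j k → cell k → cell i
  src_refl : ∀ {i k : Color} {j : ℕ+} (h : Face i j k) (x : cell k), src h (refl h x) = x
  tgt_refl : ∀ {i k : Color} {j : ℕ+} (h : Face i j k) (x : cell k), tgt h (refl h x) = x
  src_refl_of_ne : ∀ {i ij ik l : Color} {j k : ℕ+} (hj : Face i j ij) (hk : Face i k ik)
    (hjk : Face ij k l) (hkj : Face ik j l) (x : cell ij),
    src hk (refl hj x) = refl hkj (src hjk x)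
  tgt_refl_of_ne : ∀ {i ij ik l : Color} {j k : ℕ+} (hj : Face i j ij) (hk : Face i k ik)
    (hjk : Face ij k l) (hkj : Face ik j l) (x : cell ij),
    tgt hk (refl hj x) = refl hkj (tgt hjk x)
  refl_refl : ∀ {i ij ik l : Color} {j k : ℕ+} (hj : Face i j ij) (hk : Face i k ik)
    (hjk : Face ij k l) (hkj : Face ik j l) (x : cell l),
    refl hj (refl hjk x) = refl hk (refl hkj x)

/-- Multiple `∞`-magmas: `comp h a b _` is the composite of `a` and `b` in direction `j`, defined
on the pairs such that the `j`-source of `a` is the `j`-target of `b`. Here and below, an equation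
between composites is quantified over the proofs that its composites are defined; those that are
not independent hypotheses always hold by the other axioms. -/
structure MultipleMagma : Type (u + 1) extends MultipleSet.{u} where
  comp : ∀ {i k : Color} {j : ℕ+} (h : Face i j k) (a b : cell i), src h a = tgt h b → cell i
  src_comp : ∀ {i k : Color} {j : ℕ+} (h : Face i j k) (a b : cell i) (e : src h a = tgt h b),
    src h (comp h a b e) = src h b
  tgt_comp : ∀ {i k : Color} {j : ℕ+} (h : Face i j k) (a b : cell i) (e : src h a = tgt h b),
    tgt h (comp h a b e) = tgt h a
  src_comp_of_ne : ∀ {i ij ik l : Color} {j k : ℕ+} (hj : Face i j ij) (hk : Face i k ik)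
    (hkj : Face ik j l) (a b : cell i) (e : src hj a = tgt hj b)
    (e₁ : src hkj (src hk a) = tgt hkj (src hk b)),
    src hk (comp hj a b e) = comp hkj (src hk a) (src hk b) e₁
  tgt_comp_of_ne : ∀ {i ij ik l : Color} {j k : ℕ+} (hj : Face i j ij) (hk : Face i k ik)
    (hkj : Face ik j l) (a b : cell i) (e : src hj a = tgt hj b)
    (e₁ : src hkj (tgt hk a) = tgt hkj (tgt hk b)),
    tgt hk (comp hj a b e) = comp hkj (tgt hk a) (tgt hk b) e₁

/-- Reflexive multiple `∞`-magmas. In the axiom, `i = ik + k` and `j` is an entry of `ik`. -/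
structure ReflMultipleMagma : Type (u + 1) extends ReflMultipleSet.{u}, MultipleMagma.{u} where
  refl_comp : ∀ {i ij ik l : Color} {j k : ℕ+} (hj : Face i j ij) (hk : Face i k ik)
    (hkj : Face ik j l) (a b : cell ik) (e : src hkj a = tgt hkj b)
    (e₁ : src hj (refl hk a) = tgt hj (refl hk b)),
    refl hk (comp hkj a b e) = comp hj (refl hk a) (refl hk b) e₁

/-- Morphisms of reflexive multiple `∞`-magmas. -/
@[ext]
structure ReflMultipleMagma.Hom (A B : ReflMultipleMagma.{u}) : Type u extends
    MultipleSet.Hom A.toMultipleSet B.toMultipleSet where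
  map_refl : ∀ {i k : Color} {j : ℕ+} (h : Face i j k) (x : A.cell k),
    map (A.refl h x) = B.refl h (map x)
  map_comp : ∀ {i k : Color} {j : ℕ+} (h : Face i j k) (a b : A.cell i)
    (e : A.src h a = A.tgt h b) (e₁ : B.src h (map a) = B.tgt h (map b)),
    map (A.comp h a b e) = B.comp h (map a) (map b) e₁

/-- The category of reflexive multiple `∞`-magmas. -/
instance : Category.{u} ReflMultipleMagma.{u} where
  Hom A B := ReflMultipleMagma.Hom A B
  id A :=
    { map := fun x => x
      map_src := fun _ _ => rfl
      map_tgt := fun _ _ => rfl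
      map_refl := fun _ _ => rfl
      map_comp := fun _ _ _ _ _ => rfl }
  comp f g :=
    { map := fun x => g.map (f.map x)
      map_src := fun h x => by rw [f.map_src, g.map_src]
      map_tgt := fun h x => by rw [f.map_tgt, g.map_tgt]
      map_refl := fun h x => by rw [f.map_refl, g.map_refl]
      map_comp := fun h a b e e₁ => by
        have e₂ := by simpa only [f.map_src, f.map_tgt] using congrArg f.map e
        rw [f.map_comp h a b e e₂, g.map_comp h _ _ e₂ e₁] }

/-- The forgetful functor from reflexive multiple `∞`-magmas to multiple sets. -/
def ReflMultipleMagma.forget : ReflMultipleMagma.{u} ⥤ MultipleSet.{u} where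
  obj A := A.toMultipleSet
  map f := f.toHom

/-- Strict multiple `∞`-categories: all compositions are associative and unital, and compositions
in two distinct directions satisfy the middle-four interchange axiom. -/
structure StrictMultipleCat : Type (u + 1) extends ReflMultipleMagma.{u} where
  assoc : ∀ {i k : Color} {j : ℕ+} (h : Face i j k) (a b c : cell i)
    (e₁ : src h a = tgt h b) (e₂ : src h (comp h a b e₁) = tgt h c)
    (e₃ : src h b = tgt h c) (e₄ : src h a = tgt h (comp h b c e₃)),
    comp h (comp h a b e₁) c e₂ = comp h a (comp h b c e₃) e₄
  comp_refl : ∀ {i k : Color} {j : ℕ+} (h : Face i j k) (a : cell i)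
    (e : src h a = tgt h (refl h (src h a))),
    comp h a (refl h (src h a)) e = a
  refl_tgt_comp : ∀ {i k : Color} {j : ℕ+} (h : Face i j k) (a : cell i)
    (e : src h (refl h (tgt h a)) = tgt h a),
    comp h (refl h (tgt h a)) a e = a
  interchange : ∀ {i ij ik : Color} {j k : ℕ+} (hj : Face i j ij) (hk : Face i k ik), j ≠ k →
    ∀ (a b c d : cell i)
      (e₁ : src hj a = tgt hj b) (e₂ : src hj c = tgt hj d)
      (e₃ : src hk (comp hj a b e₁) = tgt hk (comp hj c d e₂))
      (e₄ : src hk a = tgt hk c) (e₅ : src hk b = tgt hk d)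
      (e₆ : src hj (comp hk a c e₄) = tgt hj (comp hk b d e₅)),
      comp hk (comp hj a b e₁) (comp hj c d e₂) e₃ =
        comp hj (comp hk a c e₄) (comp hk b d e₅) e₆

/-- Multiple categorical stretchings. If `h : Face k r i`, that is `k = i + r`, then
`bracket h α β _` is the cell `[α; β]` of color `i + r`, defined on the pairs of cells of color `i`
with the same image under `π`. -/
structure Stretching : Type (u + 1) where
  M : ReflMultipleMagma.{u}
  C : StrictMultipleCat.{u}
  π : M ⟶ C.toReflMultipleMagma
  bracket : ∀ {i k : Color} {r : ℕ+}, Face k r i → ∀ α β : M.cell i,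
    π.map α = π.map β → M.cell k
  src_bracket : ∀ {i k : Color} {r : ℕ+} (h : Face k r i) (α β : M.cell i)
    (e : π.map α = π.map β), M.src h (bracket h α β e) = α
  tgt_bracket : ∀ {i k : Color} {r : ℕ+} (h : Face k r i) (α β : M.cell i)
    (e : π.map α = π.map β), M.tgt h (bracket h α β e) = β
  src_bracket_of_ne : ∀ {i k ip kp : Color} {r p : ℕ+} (h : Face k r i) (hp : Face i p ip)
    (hkp : Face k p kp) (hr : Face kp r ip) (α β : M.cell i) (e : π.map α = π.map β)
    (e₁ : π.map (M.src hp α) = π.map (M.src hp β)),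
    M.src hkp (bracket h α β e) = bracket hr (M.src hp α) (M.src hp β) e₁
  tgt_bracket_of_ne : ∀ {i k ip kp : Color} {r p : ℕ+} (h : Face k r i) (hp : Face i p ip)
    (hkp : Face k p kp) (hr : Face kp r ip) (α β : M.cell i) (e : π.map α = π.map β)
    (e₁ : π.map (M.tgt hp α) = π.map (M.tgt hp β)),
    M.tgt hkp (bracket h α β e) = bracket hr (M.tgt hp α) (M.tgt hp β) e₁
  π_bracket : ∀ {i k : Color} {r : ℕ+} (h : Face k r i) (α β : M.cell i)
    (e : π.map α = π.map β), π.map (bracket h α β e) = C.refl h (π.map α)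

/-- Morphisms of multiple categorical stretchings: commutative squares of reflexive multiple
`∞`-magmas that respect the brackets. -/
@[ext]
structure Stretching.Hom (E F : Stretching.{u}) : Type u where
  m : E.M ⟶ F.M
  c : E.C.toReflMultipleMagma ⟶ F.C.toReflMultipleMagma
  comm : E.π ≫ c = m ≫ F.π
  map_bracket : ∀ {i k : Color} {r : ℕ+} (h : Face k r i) (α β : E.M.cell i)
    (e : E.π.map α = E.π.map β) (e₁ : F.π.map (m.map α) = F.π.map (m.map β)),
    m.map (E.bracket h α β e) = F.bracket h (m.map α) (m.map β) e₁

/-- The category of multiple categorical stretchings. -/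
instance : Category.{u} Stretching.{u} where
  Hom E F := Stretching.Hom E F
  id E :=
    { m := 𝟙 E.M
      c := 𝟙 E.C.toReflMultipleMagma
      comm := by simp
      map_bracket := fun _ _ _ _ _ => rfl }
  comp {E F G} f g :=
    { m := f.m ≫ g.m
      c := f.c ≫ g.c
      comm := by rw [← Category.assoc, f.comm, Category.assoc, g.comm, Category.assoc]
      map_bracket := fun h α β e e₁ => by
        have key : ∀ {i : Color} (x : E.M.cell i),
            F.π.map (f.m.map x) = f.c.map (E.π.map x) := fun x =>
          (congrArg (fun q : E.M ⟶ F.C.toReflMultipleMagma => q.map x) f.comm).symm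
        have e₂ : F.π.map (f.m.map α) = F.π.map (f.m.map β) := by rw [key, key, e]
        exact (congrArg g.m.map (f.map_bracket h α β e e₂)).trans
          (g.map_bracket h _ _ e₂ e₁) }

/-- The forgetful functor from multiple categorical stretchings to multiple sets, sending a
stretching to the multiple set underlying its magma `M`. -/
def Stretching.forget : Stretching.{u} ⥤ MultipleSet.{u} where
  obj E := ReflMultipleMagma.forget.obj E.M
  map f := ReflMultipleMagma.forget.map f.m

/-! Stretchings are models of an essentially algebraic theory, so the free one on `X` should consist
of formal terms modulo provable equality. The difficulty is circular: a composite or bracket is a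
legitimate term only if certain cells are equal, and that equality is what is being defined.

The circle is cut semantically. Terms are unrestricted, and each has a partial value in every
stretching under `X`. A cell is a term with a value in all of them, and two terms give the same cell
when all their values agree. Models form a large collection, but cells are a quotient of a set of
terms, so they stay in universe `u`. Equations and definedness are tested model by model
(`ValueClass.ext`), hence every axiom is inherited from the models.

Evaluation at a model is the required morphism (`lift`). It is unique by induction on terms
(`m_map_eq_val`, `c_map_eq_val`). Since `U` forgets `C`, the generators of the strict category are
just the formal projections of magma terms. -/

/-! ### Classes of partially evaluated terms -/

section ValueClass

universe v w₁ w₂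

variable {T : Type v} {I : Type w₁} {A : I → Type w₂} (ev : ∀ m, T → Part (A m))

/-- The terms that have a value under all evaluations `ev m`, identified when all their values
agree. -/
def ValueClass : Type v :=
  Quotient (α := {t : T // ∀ m, (ev m t).Dom})
    { r := fun s t => ∀ m, ev m s.1 = ev m t.1
      iseqv := ⟨fun _ _ => rfl, fun h m => (h m).symm, fun h h' m => (h m).trans (h' m)⟩ }

namespace ValueClass

variable {ev}

/-- A term representing a class. -/
noncomputable def rep (x : ValueClass ev) : T := (Quotient.out x).1

/-- The value of a class under the evaluation `ev m`. -/
noncomputable def val (x : ValueClass ev) (m : I) : A m :=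
  (ev m x.rep).get ((Quotient.out x).2 m)

theorem val_mem (x : ValueClass ev) (m : I) : x.val m ∈ ev m x.rep := Part.get_mem _

/-- The class of a term with known values. -/
def of (t : T) (φ : ∀ m, A m) (h : ∀ m, φ m ∈ ev m t) : ValueClass ev :=
  Quotient.mk _ ⟨t, fun m => Part.dom_iff_mem.2 ⟨_, h m⟩⟩

@[simp]
theorem val_of (t : T) (φ : ∀ m, A m) (h : ∀ m, φ m ∈ ev m t) (m : I) : (of t φ h).val m = φ m := by
  -- The chosen representative need not be `t`, but it has the same values.
  have key : ev m (of t φ h).rep = ev m t :=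
    Quotient.exact (Quotient.out_eq (of t φ h)) m
  exact Part.mem_unique (key ▸ val_mem (of t φ h) m) (h m)

/-- Both representatives are defined everywhere, so equal values make their partial evaluations
equal. -/
theorem ext {x y : ValueClass ev} (h : ∀ m, x.val m = y.val m) : x = y := by
  rw [← Quotient.out_eq x, ← Quotient.out_eq y]
  refine Quotient.sound fun m => ?_
  have hx := val_mem x m
  rw [h m] at hx
  exact (Part.eq_some_iff.2 hx).trans (Part.eq_some_iff.2 (val_mem y m)).symm

theorem val_congr {x y : ValueClass ev} (h : x = y) (m : I) : x.val m = y.val m := h ▸ rfl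

end ValueClass

end ValueClass

/-! ### Formal terms and their partial evaluation in models -/

namespace FreeStretching

/-- Formal cells of the magma of the free stretching on `X`, regardless of whether the composites
and brackets in them are defined. -/
inductive MagmaTerm (X : MultipleSet.{u}) : Color → Type u
  | gen {i : Color} (x : X.cell i) : MagmaTerm X i
  | src {i k : Color} {j : ℕ+} (h : Face i j k) (a : MagmaTerm X i) : MagmaTerm X k
  | tgt {i k : Color} {j : ℕ+} (h : Face i j k) (a : MagmaTerm X i) : MagmaTerm X k
  | refl {i k : Color} {j : ℕ+} (h : Face i j k) (a : MagmaTerm X k) : MagmaTerm X i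
  | comp {i k : Color} {j : ℕ+} (h : Face i j k) (a b : MagmaTerm X i) : MagmaTerm X i
  | bracket {i k : Color} {r : ℕ+} (h : Face k r i) (a b : MagmaTerm X i) : MagmaTerm X k

/-- Formal cells of the strict multiple category of the free stretching on `X`. -/
inductive CatTerm (X : MultipleSet.{u}) : Color → Type u
  | proj {i : Color} (a : MagmaTerm X i) : CatTerm X i
  | src {i k : Color} {j : ℕ+} (h : Face i j k) (a : CatTerm X i) : CatTerm X k
  | tgt {i k : Color} {j : ℕ+} (h : Face i j k) (a : CatTerm X i) : CatTerm X k
  | refl {i k : Color} {j : ℕ+} (h : Face i j k) (a : CatTerm X k) : CatTerm X i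
  | comp {i k : Color} {j : ℕ+} (h : Face i j k) (a b : CatTerm X i) : CatTerm X i

/-- A stretching under `X`. -/
structure Model (X : MultipleSet.{u}) : Type (u + 1) where
  E : Stretching.{u}
  f : MultipleSet.Hom X E.M.toMultipleSet

variable {X : MultipleSet.{u}}

/-- The partial evaluation of formal magma cells in a stretching under `X`. -/
def evalM (m : Model X) : ∀ {i : Color}, MagmaTerm X i → Part (m.E.M.cell i)
  | _, .gen x => Part.some (m.f.map x)
  | _, .src h a => (evalM m a).map (m.E.M.src h)
  | _, .tgt h a => (evalM m a).map (m.E.M.tgt h)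
  | _, .refl h a => (evalM m a).map (m.E.M.refl h)
  | _, .comp h a b => (evalM m a).bind fun x => (evalM m b).bind fun y =>
      ⟨m.E.M.src h x = m.E.M.tgt h y, m.E.M.comp h x y⟩
  | _, .bracket h a b => (evalM m a).bind fun x => (evalM m b).bind fun y =>
      ⟨m.E.π.map x = m.E.π.map y, m.E.bracket h x y⟩

/-- The partial evaluation of formal cells of the strict multiple category. -/
def evalC (m : Model X) : ∀ {i : Color}, CatTerm X i → Part (m.E.C.cell i)
  | _, .proj a => (evalM m a).map m.E.π.map
  | _, .src h a => (evalC m a).map (m.E.C.src h)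
  | _, .tgt h a => (evalC m a).map (m.E.C.tgt h)
  | _, .refl h a => (evalC m a).map (m.E.C.refl h)
  | _, .comp h a b => (evalC m a).bind fun x => (evalC m b).bind fun y =>
      ⟨m.E.C.src h x = m.E.C.tgt h y, m.E.C.comp h x y⟩

/-- Definedness of a compound term passes to its subterms and yields the side condition; the
uniqueness induction rests on this. -/
theorem mem_evalM_comp {m : Model X} {i k : Color} {j : ℕ+} {h : Face i j k} {a b : MagmaTerm X i}
    {z : m.E.M.cell i} : z ∈ evalM m (.comp h a b) ↔
      ∃ x ∈ evalM m a, ∃ y ∈ evalM m b, ∃ e, m.E.M.comp h x y e = z := by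
  simp only [evalM, Part.mem_bind_iff]; rfl

theorem mem_evalM_bracket {m : Model X} {i k : Color} {r : ℕ+} {h : Face k r i}
    {a b : MagmaTerm X i} {z : m.E.M.cell k} : z ∈ evalM m (.bracket h a b) ↔
      ∃ x ∈ evalM m a, ∃ y ∈ evalM m b, ∃ e, m.E.bracket h x y e = z := by
  simp only [evalM, Part.mem_bind_iff]; rfl

theorem mem_evalC_comp {m : Model X} {i k : Color} {j : ℕ+} {h : Face i j k} {a b : CatTerm X i}
    {z : m.E.C.cell i} : z ∈ evalC m (.comp h a b) ↔
      ∃ x ∈ evalC m a, ∃ y ∈ evalC m b, ∃ e, m.E.C.comp h x y e = z := by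
  simp only [evalC, Part.mem_bind_iff]; rfl

/-! ### Cells and the operations on them -/

variable (X) in
/-- The cells of the magma of the free stretching on `X`. -/
abbrev MagmaCell (i : Color) : Type u := ValueClass fun m : Model X => evalM m (i := i)

variable (X) in
/-- The cells of the strict multiple category of the free stretching on `X`. -/
abbrev CatCell (i : Color) : Type u := ValueClass fun m : Model X => evalC m (i := i)

namespace MagmaCell

variable {i k : Color} {j : ℕ+}

noncomputable def gen (x : X.cell i) : MagmaCell X i :=
  .of (.gen x) (fun m => m.f.map x) fun _ => Part.mem_some _

noncomputable def src (h : Face i j k) (x : MagmaCell X i) : MagmaCell X k :=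
  .of (.src h x.rep) (fun m => m.E.M.src h (x.val m)) fun m => Part.mem_map _ (x.val_mem m)

noncomputable def tgt (h : Face i j k) (x : MagmaCell X i) : MagmaCell X k :=
  .of (.tgt h x.rep) (fun m => m.E.M.tgt h (x.val m)) fun m => Part.mem_map _ (x.val_mem m)

noncomputable def refl (h : Face i j k) (x : MagmaCell X k) : MagmaCell X i :=
  .of (.refl h x.rep) (fun m => m.E.M.refl h (x.val m)) fun m => Part.mem_map _ (x.val_mem m)

/-- Composability is required in each model, exactly what makes the formal composite defined
everywhere; `comp_cond` derives it from an equality of cells. -/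
noncomputable def comp (h : Face i j k) (x y : MagmaCell X i)
    (e : ∀ m : Model X, m.E.M.src h (x.val m) = m.E.M.tgt h (y.val m)) : MagmaCell X i :=
  .of (.comp h x.rep y.rep) (fun m => m.E.M.comp h (x.val m) (y.val m) (e m)) fun m =>
    mem_evalM_comp.2 ⟨_, x.val_mem m, _, y.val_mem m, e m, rfl⟩

noncomputable def bracket (h : Face k j i) (x y : MagmaCell X i)
    (e : ∀ m : Model X, m.E.π.map (x.val m) = m.E.π.map (y.val m)) : MagmaCell X k :=
  .of (.bracket h x.rep y.rep) (fun m => m.E.bracket h (x.val m) (y.val m) (e m)) fun m =>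
    mem_evalM_bracket.2 ⟨_, x.val_mem m, _, y.val_mem m, e m, rfl⟩

@[simp]
theorem val_of {t : MagmaTerm X i} {φ : ∀ m : Model X, m.E.M.cell i}
    {h : ∀ m, φ m ∈ evalM m t} (m : Model X) :
    ValueClass.val (A := fun m : Model X => m.E.M.cell i) (ev := fun m => evalM m)
      (.of t φ h) m = φ m :=
  ValueClass.val_of ..

@[simp]
theorem val_src (h : Face i j k) (x : MagmaCell X i) (m : Model X) :
    (src h x).val m = m.E.M.src h (x.val m) := ValueClass.val_of ..

@[simp]
theorem val_tgt (h : Face i j k) (x : MagmaCell X i) (m : Model X) :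
    (tgt h x).val m = m.E.M.tgt h (x.val m) := ValueClass.val_of ..

@[simp]
theorem val_refl (h : Face i j k) (x : MagmaCell X k) (m : Model X) :
    (refl h x).val m = m.E.M.refl h (x.val m) := ValueClass.val_of ..

@[simp]
theorem val_comp (h : Face i j k) (x y : MagmaCell X i)
    (e : ∀ m : Model X, m.E.M.src h (x.val m) = m.E.M.tgt h (y.val m)) (m : Model X) :
    (comp h x y e).val m = m.E.M.comp h (x.val m) (y.val m) (e m) := ValueClass.val_of ..

@[simp]
theorem val_gen (x : X.cell i) (m : Model X) : (gen x).val m = m.f.map x := ValueClass.val_of ..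

@[simp]
theorem val_bracket (h : Face k j i) (x y : MagmaCell X i)
    (e : ∀ m : Model X, m.E.π.map (x.val m) = m.E.π.map (y.val m)) (m : Model X) :
    (bracket h x y e).val m = m.E.bracket h (x.val m) (y.val m) (e m) := ValueClass.val_of ..

theorem comp_cond {h : Face i j k} {x y : MagmaCell X i} (e : src h x = tgt h y) (m : Model X) :
    m.E.M.src h (x.val m) = m.E.M.tgt h (y.val m) := by
  simpa using ValueClass.val_congr e m

end MagmaCell

namespace CatCell

variable {i k : Color} {j : ℕ+}

noncomputable def proj (x : MagmaCell X i) : CatCell X i :=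
  .of (.proj x.rep) (fun m => m.E.π.map (x.val m)) fun m => Part.mem_map _ (x.val_mem m)

noncomputable def src (h : Face i j k) (x : CatCell X i) : CatCell X k :=
  .of (.src h x.rep) (fun m => m.E.C.src h (x.val m)) fun m => Part.mem_map _ (x.val_mem m)

noncomputable def tgt (h : Face i j k) (x : CatCell X i) : CatCell X k :=
  .of (.tgt h x.rep) (fun m => m.E.C.tgt h (x.val m)) fun m => Part.mem_map _ (x.val_mem m)

noncomputable def refl (h : Face i j k) (x : CatCell X k) : CatCell X i :=
  .of (.refl h x.rep) (fun m => m.E.C.refl h (x.val m)) fun m => Part.mem_map _ (x.val_mem m)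

noncomputable def comp (h : Face i j k) (x y : CatCell X i)
    (e : ∀ m : Model X, m.E.C.src h (x.val m) = m.E.C.tgt h (y.val m)) : CatCell X i :=
  .of (.comp h x.rep y.rep) (fun m => m.E.C.comp h (x.val m) (y.val m) (e m)) fun m =>
    mem_evalC_comp.2 ⟨_, x.val_mem m, _, y.val_mem m, e m, rfl⟩

@[simp]
theorem val_of {t : CatTerm X i} {φ : ∀ m : Model X, m.E.C.cell i}
    {h : ∀ m, φ m ∈ evalC m t} (m : Model X) :
    ValueClass.val (A := fun m : Model X => m.E.C.cell i) (ev := fun m => evalC m)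
      (.of t φ h) m = φ m :=
  ValueClass.val_of ..

@[simp]
theorem val_src (h : Face i j k) (x : CatCell X i) (m : Model X) :
    (src h x).val m = m.E.C.src h (x.val m) := ValueClass.val_of ..

@[simp]
theorem val_tgt (h : Face i j k) (x : CatCell X i) (m : Model X) :
    (tgt h x).val m = m.E.C.tgt h (x.val m) := ValueClass.val_of ..

@[simp]
theorem val_refl (h : Face i j k) (x : CatCell X k) (m : Model X) :
    (refl h x).val m = m.E.C.refl h (x.val m) := ValueClass.val_of ..

@[simp]
theorem val_comp (h : Face i j k) (x y : CatCell X i)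
    (e : ∀ m : Model X, m.E.C.src h (x.val m) = m.E.C.tgt h (y.val m)) (m : Model X) :
    (comp h x y e).val m = m.E.C.comp h (x.val m) (y.val m) (e m) := ValueClass.val_of ..

@[simp]
theorem val_proj (x : MagmaCell X i) (m : Model X) :
    (proj x).val m = m.E.π.map (x.val m) := ValueClass.val_of ..

theorem comp_cond {h : Face i j k} {x y : CatCell X i} (e : src h x = tgt h y) (m : Model X) :
    m.E.C.src h (x.val m) = m.E.C.tgt h (y.val m) := by
  simpa using ValueClass.val_congr e m

theorem bracket_cond {x y : MagmaCell X i} (e : proj x = proj y) (m : Model X) :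
    m.E.π.map (x.val m) = m.E.π.map (y.val m) := by
  simpa using ValueClass.val_congr e m

end CatCell

/-! ### The free stretching and its generators -/

variable (X)

/-- The magma of the free stretching on `X`. -/
noncomputable def magma : ReflMultipleMagma.{u} where
  cell := MagmaCell X
  src := MagmaCell.src
  tgt := MagmaCell.tgt
  refl := MagmaCell.refl
  comp h x y e := MagmaCell.comp h x y (MagmaCell.comp_cond e)
  src_src hj hk hjk hkj x := ValueClass.ext fun m => by
    simpa using m.E.M.src_src hj hk hjk hkj (x.val m)
  tgt_tgt hj hk hjk hkj x := ValueClass.ext fun m => by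
    simpa using m.E.M.tgt_tgt hj hk hjk hkj (x.val m)
  tgt_src hj hk hjk hkj x := ValueClass.ext fun m => by
    simpa using m.E.M.tgt_src hj hk hjk hkj (x.val m)
  src_refl h x := ValueClass.ext fun m => by
    simpa using m.E.M.src_refl h (x.val m)
  tgt_refl h x := ValueClass.ext fun m => by
    simpa using m.E.M.tgt_refl h (x.val m)
  src_refl_of_ne hj hk hjk hkj x := ValueClass.ext fun m => by
    simpa using m.E.M.src_refl_of_ne hj hk hjk hkj (x.val m)
  tgt_refl_of_ne hj hk hjk hkj x := ValueClass.ext fun m => by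
    simpa using m.E.M.tgt_refl_of_ne hj hk hjk hkj (x.val m)
  refl_refl hj hk hjk hkj x := ValueClass.ext fun m => by
    simpa using m.E.M.refl_refl hj hk hjk hkj (x.val m)
  src_comp h x y e := ValueClass.ext fun m => by
    simpa using m.E.M.src_comp h (x.val m) (y.val m) _
  tgt_comp h x y e := ValueClass.ext fun m => by
    simpa using m.E.M.tgt_comp h (x.val m) (y.val m) _
  src_comp_of_ne hj hk hkj x y e e₁ := ValueClass.ext fun m => by
    simpa using
      m.E.M.src_comp_of_ne hj hk hkj (x.val m) (y.val m) (MagmaCell.comp_cond e m)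
        (by simpa using MagmaCell.comp_cond e₁ m)
  tgt_comp_of_ne hj hk hkj x y e e₁ := ValueClass.ext fun m => by
    simpa using
      m.E.M.tgt_comp_of_ne hj hk hkj (x.val m) (y.val m) (MagmaCell.comp_cond e m)
        (by simpa using MagmaCell.comp_cond e₁ m)
  refl_comp hj hk hkj x y e e₁ := ValueClass.ext fun m => by
    simpa using
      m.E.M.refl_comp hj hk hkj (x.val m) (y.val m) (MagmaCell.comp_cond e m)
        (by simpa using MagmaCell.comp_cond e₁ m)

/-- The strict multiple category of the free stretching on `X`. -/
noncomputable def cat : StrictMultipleCat.{u} where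
  cell := CatCell X
  src := CatCell.src
  tgt := CatCell.tgt
  refl := CatCell.refl
  comp h x y e := CatCell.comp h x y (CatCell.comp_cond e)
  src_src hj hk hjk hkj x := ValueClass.ext fun m => by
    simpa using m.E.C.src_src hj hk hjk hkj (x.val m)
  tgt_tgt hj hk hjk hkj x := ValueClass.ext fun m => by
    simpa using m.E.C.tgt_tgt hj hk hjk hkj (x.val m)
  tgt_src hj hk hjk hkj x := ValueClass.ext fun m => by
    simpa using m.E.C.tgt_src hj hk hjk hkj (x.val m)
  src_refl h x := ValueClass.ext fun m => by
    simpa using m.E.C.src_refl h (x.val m)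
  tgt_refl h x := ValueClass.ext fun m => by
    simpa using m.E.C.tgt_refl h (x.val m)
  src_refl_of_ne hj hk hjk hkj x := ValueClass.ext fun m => by
    simpa using m.E.C.src_refl_of_ne hj hk hjk hkj (x.val m)
  tgt_refl_of_ne hj hk hjk hkj x := ValueClass.ext fun m => by
    simpa using m.E.C.tgt_refl_of_ne hj hk hjk hkj (x.val m)
  refl_refl hj hk hjk hkj x := ValueClass.ext fun m => by
    simpa using m.E.C.refl_refl hj hk hjk hkj (x.val m)
  src_comp h x y e := ValueClass.ext fun m => by
    simpa using m.E.C.src_comp h (x.val m) (y.val m) _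
  tgt_comp h x y e := ValueClass.ext fun m => by
    simpa using m.E.C.tgt_comp h (x.val m) (y.val m) _
  src_comp_of_ne hj hk hkj x y e e₁ := ValueClass.ext fun m => by
    simpa using
      m.E.C.src_comp_of_ne hj hk hkj (x.val m) (y.val m) (CatCell.comp_cond e m)
        (by simpa using CatCell.comp_cond e₁ m)
  tgt_comp_of_ne hj hk hkj x y e e₁ := ValueClass.ext fun m => by
    simpa using
      m.E.C.tgt_comp_of_ne hj hk hkj (x.val m) (y.val m) (CatCell.comp_cond e m)
        (by simpa using CatCell.comp_cond e₁ m)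
  refl_comp hj hk hkj x y e e₁ := ValueClass.ext fun m => by
    simpa using
      m.E.C.refl_comp hj hk hkj (x.val m) (y.val m) (CatCell.comp_cond e m)
        (by simpa using CatCell.comp_cond e₁ m)
  assoc h x y z e₁ e₂ e₃ e₄ := ValueClass.ext fun m => by
    simpa using
      m.E.C.assoc h (x.val m) (y.val m) (z.val m) (CatCell.comp_cond e₁ m)
        (by simpa using CatCell.comp_cond e₂ m) (CatCell.comp_cond e₃ m)
        (by simpa using CatCell.comp_cond e₄ m)
  comp_refl h x e := ValueClass.ext fun m => by
    simpa using
      m.E.C.comp_refl h (x.val m)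
        (by simpa using CatCell.comp_cond e m)
  refl_tgt_comp h x e := ValueClass.ext fun m => by
    simpa using
      m.E.C.refl_tgt_comp h (x.val m)
        (by simpa using CatCell.comp_cond e m)
  interchange hj hk hne x y z w e₁ e₂ e₃ e₄ e₅ e₆ := ValueClass.ext fun m => by
    simpa using
      m.E.C.interchange hj hk hne (x.val m) (y.val m) (z.val m) (w.val m)
        (CatCell.comp_cond e₁ m) (CatCell.comp_cond e₂ m)
        (by simpa using CatCell.comp_cond e₃ m)
        (CatCell.comp_cond e₄ m) (CatCell.comp_cond e₅ m)
        (by simpa using CatCell.comp_cond e₆ m)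

/-- The projection of the free stretching on `X`. -/
noncomputable def proj : ReflMultipleMagma.Hom (magma X) (cat X).toReflMultipleMagma where
  map := CatCell.proj
  map_src h (x : MagmaCell X _) := ValueClass.ext fun m => by
    change (CatCell.proj (.src h x)).val m = (CatCell.src h (.proj x)).val m
    simpa using m.E.π.map_src h (x.val m)
  map_tgt h (x : MagmaCell X _) := ValueClass.ext fun m => by
    change (CatCell.proj (.tgt h x)).val m = (CatCell.tgt h (.proj x)).val m
    simpa using m.E.π.map_tgt h (x.val m)
  map_refl h (x : MagmaCell X _) := ValueClass.ext fun m => by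
    change (CatCell.proj (.refl h x)).val m = (CatCell.refl h (.proj x)).val m
    simpa using m.E.π.map_refl h (x.val m)
  map_comp h (x y : MagmaCell X _) e e₁ := ValueClass.ext fun m => by
    have hπ := CatCell.comp_cond (x := .proj x) (y := .proj y) e₁
    change (CatCell.proj (.comp h x y (MagmaCell.comp_cond e))).val m =
      (CatCell.comp h (.proj x) (.proj y) hπ).val m
    simpa using m.E.π.map_comp h (x.val m) (y.val m) (MagmaCell.comp_cond e m)
      (by simpa using hπ m)

/-- The free stretching on `X`. -/
noncomputable def stretching : Stretching.{u} where
  M := magma X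
  C := cat X
  π := proj X
  bracket h (x y : MagmaCell X _) e := MagmaCell.bracket h x y (CatCell.bracket_cond e)
  src_bracket h (x y : MagmaCell X _) e := ValueClass.ext fun m => by
    change (MagmaCell.src h (.bracket h x y _)).val m = x.val m
    simpa using m.E.src_bracket h (x.val m) (y.val m) (CatCell.bracket_cond e m)
  tgt_bracket h (x y : MagmaCell X _) e := ValueClass.ext fun m => by
    change (MagmaCell.tgt h (.bracket h x y _)).val m = y.val m
    simpa using m.E.tgt_bracket h (x.val m) (y.val m) (CatCell.bracket_cond e m)
  src_bracket_of_ne h hp hkp hr (x y : MagmaCell X _) e e₁ := ValueClass.ext fun m => by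
    have hπ := CatCell.bracket_cond (x := .src hp x) (y := .src hp y) e₁
    change (MagmaCell.src hkp (.bracket h x y _)).val m =
      (MagmaCell.bracket hr (.src hp x) (.src hp y) hπ).val m
    simpa using m.E.src_bracket_of_ne h hp hkp hr (x.val m) (y.val m) (CatCell.bracket_cond e m)
      (by simpa using hπ m)
  tgt_bracket_of_ne h hp hkp hr (x y : MagmaCell X _) e e₁ := ValueClass.ext fun m => by
    have hπ := CatCell.bracket_cond (x := .tgt hp x) (y := .tgt hp y) e₁
    change (MagmaCell.tgt hkp (.bracket h x y _)).val m =
      (MagmaCell.bracket hr (.tgt hp x) (.tgt hp y) hπ).val m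
    simpa using m.E.tgt_bracket_of_ne h hp hkp hr (x.val m) (y.val m) (CatCell.bracket_cond e m)
      (by simpa using hπ m)
  π_bracket h (x y : MagmaCell X _) e := ValueClass.ext fun m => by
    change (CatCell.proj (.bracket h x y _)).val m = (CatCell.refl h (.proj x)).val m
    simpa using m.E.π_bracket h (x.val m) (y.val m) (CatCell.bracket_cond e m)

/-- The inclusion of the generators. -/
noncomputable def unit : MultipleSet.Hom X (magma X).toMultipleSet where
  map := MagmaCell.gen
  map_src h x := ValueClass.ext fun m => by
    simpa [magma, MagmaCell.val_src, MagmaCell.val_gen] using m.f.map_src h x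
  map_tgt h x := ValueClass.ext fun m => by
    simpa [magma, MagmaCell.val_tgt, MagmaCell.val_gen] using m.f.map_tgt h x

/-! ### Universal property -/

variable {X}

/-- The morphism out of the free stretching on `X` given by a model. -/
noncomputable def lift (m : Model X) : Stretching.Hom (stretching X) m.E where
  m :=
    { map := fun x => ValueClass.val x m
      map_src := fun h x => MagmaCell.val_src h x m
      map_tgt := fun h x => MagmaCell.val_tgt h x m
      map_refl := fun h x => MagmaCell.val_refl h x m
      map_comp := fun h x y e _ => MagmaCell.val_comp h x y (MagmaCell.comp_cond e) m }
  c :=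
    { map := fun x => ValueClass.val x m
      map_src := fun h x => CatCell.val_src h x m
      map_tgt := fun h x => CatCell.val_tgt h x m
      map_refl := fun h x => CatCell.val_refl h x m
      map_comp := fun h x y e _ => CatCell.val_comp h x y (CatCell.comp_cond e) m }
  comm := by
    apply ReflMultipleMagma.Hom.ext
    funext i x
    exact CatCell.val_proj x m
  map_bracket := fun h x y e _ => MagmaCell.val_bracket h x y (CatCell.bracket_cond e) m

/-- The claim concerns every cell whose values are those of `t`, not only cells with chosen
representative `t`: subterms of a representative need not be representatives themselves. -/
theorem m_map_eq_val {E : Stretching.{u}} (g : Stretching.Hom (stretching X) E)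
    (f : MultipleSet.Hom X E.M.toMultipleSet)
    (hf : ∀ {i : Color} (x : X.cell i), g.m.map (MagmaCell.gen x) = f.map x)
    {i : Color} (t : MagmaTerm X i) :
    ∀ x : MagmaCell X i, (∀ m, x.val m ∈ evalM m t) → g.m.map x = x.val ⟨E, f⟩ := by
  induction t with
  | gen a =>
    intro x hx
    obtain rfl : x = MagmaCell.gen a := ValueClass.ext fun m =>
      (Part.mem_some_iff.1 (hx m)).trans (MagmaCell.val_gen a m).symm
    exact (hf a).trans (MagmaCell.val_gen a ⟨E, f⟩).symm
  | src h a ih =>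
    intro x hx
    -- The subterm has a value in every model, so it defines a cell.
    choose φ hφ e using fun m => (Part.mem_map_iff _).1 (hx m)
    obtain rfl : x = MagmaCell.src h (.of a φ hφ) := ValueClass.ext fun m => by
      simp [e]
    refine (g.m.map_src h _).trans ?_
    rw [ih _ fun m => by simpa using hφ m]
    simp
  | tgt h a ih =>
    intro x hx
    choose φ hφ e using fun m => (Part.mem_map_iff _).1 (hx m)
    obtain rfl : x = MagmaCell.tgt h (.of a φ hφ) := ValueClass.ext fun m => by
      simp [e]
    refine (g.m.map_tgt h _).trans ?_
    rw [ih _ fun m => by simpa using hφ m]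
    simp
  | refl h a ih =>
    intro x hx
    choose φ hφ e using fun m => (Part.mem_map_iff _).1 (hx m)
    obtain rfl : x = MagmaCell.refl h (.of a φ hφ) := ValueClass.ext fun m => by
      simp [e]
    refine (g.m.map_refl h _).trans ?_
    rw [ih _ fun m => by simpa using hφ m]
    simp
  | comp h a b iha ihb =>
    intro x hx
    choose φ hφ ψ hψ c e using fun m => mem_evalM_comp.1 (hx m)
    obtain ⟨y, hy⟩ : ∃ y : MagmaCell X _, ∀ m, y.val m = φ m := ⟨.of a φ hφ, by simp⟩
    obtain ⟨z, hz⟩ : ∃ z : MagmaCell X _, ∀ m, z.val m = ψ m := ⟨.of b ψ hψ, by simp⟩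
    have hc : ∀ m : Model X, m.E.M.src h (y.val m) = m.E.M.tgt h (z.val m) := fun m => by
      rw [hy, hz, c]
    obtain rfl : x = MagmaCell.comp h y z hc := ValueClass.ext fun m => by
      simp [hy, hz, e]
    have hy' := iha y fun m => hy m ▸ hφ m
    have hz' := ihb z fun m => hz m ▸ hψ m
    -- Composability in all models is composability in the free magma, so `g` preserves this
    -- composite.
    have e₀ : MagmaCell.src h y = MagmaCell.tgt h z := ValueClass.ext fun m => by
      simpa using hc m
    refine (g.m.map_comp h y z e₀ (by rw [hy', hz']; exact hc ⟨E, f⟩)).trans ?_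
    simp [hy', hz']
  | bracket h a b iha ihb =>
    intro x hx
    choose φ hφ ψ hψ c e using fun m => mem_evalM_bracket.1 (hx m)
    obtain ⟨y, hy⟩ : ∃ y : MagmaCell X _, ∀ m, y.val m = φ m := ⟨.of a φ hφ, by simp⟩
    obtain ⟨z, hz⟩ : ∃ z : MagmaCell X _, ∀ m, z.val m = ψ m := ⟨.of b ψ hψ, by simp⟩
    have hc : ∀ m : Model X, m.E.π.map (y.val m) = m.E.π.map (z.val m) := fun m => by
      rw [hy, hz, c]
    obtain rfl : x = MagmaCell.bracket h y z hc := ValueClass.ext fun m => by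
      simp [hy, hz, e]
    have hy' := iha y fun m => hy m ▸ hφ m
    have hz' := ihb z fun m => hz m ▸ hψ m
    -- Likewise, projections that agree in all models agree in `cat X`, so the bracket exists there.
    have e₀ : CatCell.proj y = CatCell.proj z := ValueClass.ext fun m => by
      simpa using hc m
    refine (g.map_bracket h y z e₀ (by rw [hy', hz']; exact hc ⟨E, f⟩)).trans ?_
    simp [hy', hz']

theorem c_map_eq_val {E : Stretching.{u}} (g : Stretching.Hom (stretching X) E)
    (f : MultipleSet.Hom X E.M.toMultipleSet)
    (hf : ∀ {i : Color} (x : X.cell i), g.m.map (MagmaCell.gen x) = f.map x)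
    {i : Color} (t : CatTerm X i) :
    ∀ x : CatCell X i, (∀ m, x.val m ∈ evalC m t) → g.c.map x = x.val ⟨E, f⟩ := by
  induction t with
  | proj a =>
    intro x hx
    choose φ hφ e using fun m => (Part.mem_map_iff _).1 (hx m)
    obtain rfl : x = CatCell.proj (.of a φ hφ) := ValueClass.ext fun m => by
      simp [e]
    -- The commuting square `g.comm` reduces generators of the strict category to the magma case.
    refine (congrArg (fun q : magma X ⟶ E.C.toReflMultipleMagma =>
      q.map (ValueClass.of a φ hφ)) g.comm).trans ?_
    refine (congrArg E.π.map
      (m_map_eq_val g f hf a (.of a φ hφ) fun m => by simpa using hφ m)).trans ?_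
    simp
  | src h a ih =>
    intro x hx
    choose φ hφ e using fun m => (Part.mem_map_iff _).1 (hx m)
    obtain rfl : x = CatCell.src h (.of a φ hφ) := ValueClass.ext fun m => by
      simp [e]
    refine (g.c.map_src h _).trans ?_
    rw [ih _ fun m => by simpa using hφ m]
    simp
  | tgt h a ih =>
    intro x hx
    choose φ hφ e using fun m => (Part.mem_map_iff _).1 (hx m)
    obtain rfl : x = CatCell.tgt h (.of a φ hφ) := ValueClass.ext fun m => by
      simp [e]
    refine (g.c.map_tgt h _).trans ?_
    rw [ih _ fun m => by simpa using hφ m]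
    simp
  | refl h a ih =>
    intro x hx
    choose φ hφ e using fun m => (Part.mem_map_iff _).1 (hx m)
    obtain rfl : x = CatCell.refl h (.of a φ hφ) := ValueClass.ext fun m => by
      simp [e]
    refine (g.c.map_refl h _).trans ?_
    rw [ih _ fun m => by simpa using hφ m]
    simp
  | comp h a b iha ihb =>
    intro x hx
    choose φ hφ ψ hψ c e using fun m => mem_evalC_comp.1 (hx m)
    obtain ⟨y, hy⟩ : ∃ y : CatCell X _, ∀ m, y.val m = φ m := ⟨.of a φ hφ, by simp⟩
    obtain ⟨z, hz⟩ : ∃ z : CatCell X _, ∀ m, z.val m = ψ m := ⟨.of b ψ hψ, by simp⟩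
    have hc : ∀ m : Model X, m.E.C.src h (y.val m) = m.E.C.tgt h (z.val m) := fun m => by
      rw [hy, hz, c]
    obtain rfl : x = CatCell.comp h y z hc := ValueClass.ext fun m => by
      simp [hy, hz, e]
    have hy' := iha y fun m => hy m ▸ hφ m
    have hz' := ihb z fun m => hz m ▸ hψ m
    have e₀ : CatCell.src h y = CatCell.tgt h z := ValueClass.ext fun m => by
      simpa using hc m
    refine (g.c.map_comp h y z e₀ (by rw [hy', hz']; exact hc ⟨E, f⟩)).trans ?_
    simp [hy', hz']

theorem eq_lift {E : Stretching.{u}} (g : Stretching.Hom (stretching X) E)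
    (f : MultipleSet.Hom X E.M.toMultipleSet)
    (hf : ∀ {i : Color} (x : X.cell i), g.m.map (MagmaCell.gen x) = f.map x) :
    g = lift ⟨E, f⟩ := by
  apply Stretching.Hom.ext
  · apply ReflMultipleMagma.Hom.ext
    funext i x
    exact m_map_eq_val g f hf _ x (ValueClass.val_mem x)
  · apply ReflMultipleMagma.Hom.ext
    funext i x
    exact c_map_eq_val g f hf _ x (ValueClass.val_mem x)

/-- The universal property of the free stretching. -/
noncomputable def homEquiv (X : MultipleSet.{u}) (E : Stretching.{u}) :
    (stretching X ⟶ E) ≃ (X ⟶ Stretching.forget.obj E) where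
  toFun g := CategoryStruct.comp (Y := Stretching.forget.obj (stretching X)) (unit X)
    (Stretching.forget.map g)
  invFun f := lift ⟨E, f⟩
  -- Here `f` is the restriction of `g` to generators, so the hypothesis of `eq_lift` is
  -- definitional.
  left_inv g := (eq_lift g _ fun _ => rfl).symm
  right_inv f := by
    apply MultipleSet.Hom.ext
    funext i x
    exact MagmaCell.val_gen x ⟨E, f⟩

theorem homEquiv_naturality_right (X : MultipleSet.{u}) (E E' : Stretching.{u}) (g : E ⟶ E')
    (h : stretching X ⟶ E) :
    homEquiv X E' (h ≫ g) = homEquiv X E h ≫ Stretching.forget.map g := rfl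

end FreeStretching

/-- Naturality in the stretching suffices: the action of `F` on morphisms is then forced by the
universal property. The monad is `adj.toMonad` itself. -/
theorem mainTheorem1 :
    ∃ (F : MultipleSet.{u} ⥤ Stretching.{u}) (adj : F ⊣ Stretching.forget.{u})
      (T : Monad MultipleSet.{u}), T = adj.toMonad :=
  ⟨_, Adjunction.adjunctionOfEquivLeft FreeStretching.homEquiv
    FreeStretching.homEquiv_naturality_right, _, rfl⟩
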